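/- Let $\mathbb F_q$ be the finite field with $q$ elements. A \emph{virtual quadratic space} over $\mathbb F_q$ is a triple $(V,Q,U)$, where $V$ is a vector space over $\mathbb F_q$, $U\subseteq V$ is a subspace, and $Q$ is a quadratic form on $V$ whose associated bilinear form $B(x,y)=Q(x+y)-Q(x)-Q(y)$ is non-degenerate on $V$. Put $U^\perp=\{v\in V: B(u,v)=0\text{ for all }u\in U\}$. The group $\mathrm{Iso}(V,U)$ consists of all linear isometries of $(V,Q)$ that fix every vector of $U^\perp$. The space $(V,Q,U)$ is called \emph{non-degenerate} if the radical of $Q|_U$, that is $\{v\in U: Q(v+u)=Q(u)\text{ for all }u\in U\}$, is $\{0\}$. For $\dim U=2k$ with $k\ge 1$, $Q|_U$ is said to be of type $\varepsilon=+1$ if it is isomorphic to $\sum_{i=1}^{k}x_{2i-1}x_{2i}$. It is said to be of type $\varepsilon=-1$ if it is isomorphic to $\sum_{i=1}^{k-1}x_{2i-1}x_{2i}+x_{2k-1}^2-e\,x_{2k}^2$ with $e$ a non-square when $q$ is odd, respectively to $\sum_{i=1}^{k-1}x_{2i-1}x_{2i}+x_{2k-1}^2+x_{2k-1}x_{2k}+e\,x_{2k}^2$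 with $e$ such that $t^2+t+e$ has no root in $\mathbb F_q$ when $q$ is even. Let $(V,Q,U)$ be a non-degenerate virtual quadratic space over $\mathbb F_q$ with $U$ finite-dimensional. Then, for $q$ odd and for $q$ even alike: (a) if $\dim U=2k$ with $k\ge 1$ and $Q|_U$ is of type $\varepsilon\in\{+1,-1\}$, then $$|\mathrm{Iso}(V,U)|=2q^{k^2-k}(q^k-\varepsilon)\prod_{i=1}^{k-1}(q^{2i}-1);$$ (b) if $\dim U=2k+1$ with $k\ge 0$, then $$|\mathrm{Iso}(V,U)|=2q^{k^2}\prod_{i=1}^{k}(q^{2i}-1).$$ -/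

import Mathlib

/-- A virtual quadratic space on the vector space `V`: a quadratic form on `V` whose associated
bilinear form `B(x, y) = Q(x + y) - Q(x) - Q(y)` is non-degenerate (every non-zero `v` has
`B(v, ·) ≠ 0`), together with a subspace of `V`. -/
structure VirtualQuadraticSpace (K V : Type*) [Field K] [AddCommGroup V] [Module K V] where
  /-- the quadratic form `Q` on `V` -/
  form : QuadraticForm K V
  /-- the subspace `U` of `V` -/
  subspace : Submodule K V
  /-- the associated bilinear form is non-degenerate on `V` -/
  separating : form.polarBilin.SeparatingLeft

namespace VirtualQuadraticSpace

variable {K V : Type*} [Field K] [AddCommGroup V] [Module K V]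

/-- The quadratic space `(U, Q|_U)`. -/
def subform (S : VirtualQuadraticSpace K V) : QuadraticForm K S.subspace :=
  S.form.restrict S.subspace

/-- The orthogonal complement of `U` in `V` with respect to the associated bilinear form. -/
def perp (S : VirtualQuadraticSpace K V) : Submodule K V :=
  S.subspace.orthogonalBilin S.form.polarBilin

/-- The virtual quadratic space is non-degenerate if the radical of `Q|_U`, consisting of the
`v ∈ U` with `Q(v + u) = Q(u)` for all `u ∈ U`, is zero. -/
def IsNondegenerate (S : VirtualQuadraticSpace K V) : Prop :=
  S.subform.radical = ⊥

/-- The group `Iso(V, U)` of the isometries of `(V, Q)` that fix every vector of the orthogonal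
complement of `U`. -/
def isometryGroup (S : VirtualQuadraticSpace K V) : Subgroup (V ≃ₗ[K] V) where
  carrier := {f | (∀ v, S.form (f v) = S.form v) ∧ ∀ w ∈ S.perp, f w = w}
  one_mem' := ⟨fun _ => rfl, fun _ _ => rfl⟩
  mul_mem' := by
    rintro f g ⟨hf, hf'⟩ ⟨hg, hg'⟩
    refine ⟨fun v => ?_, fun w hw => ?_⟩
    · rw [LinearEquiv.mul_apply, hf, hg]
    · rw [LinearEquiv.mul_apply, hg' w hw, hf' w hw]
  inv_mem' := by
    rintro f ⟨hf, hf'⟩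
    have key : ∀ v, f (f⁻¹ v) = v := fun v => LinearEquiv.apply_symm_apply f v
    refine ⟨fun v => ?_, fun w hw => ?_⟩
    · rw [← hf (f⁻¹ v), key]
    · apply f.injective
      rw [key, hf' w hw]

end VirtualQuadraticSpace

namespace QuadraticForm

/-- The form `x₁x₂ + x₃x₄ + ⋯ + x₂ₖ₋₁x₂ₖ` on the space of `k`-tuples of pairs. -/
def splitForm (K : Type*) [Field K] (k : ℕ) : QuadraticForm K (Fin k → K × K) :=
  QuadraticMap.pi fun _ => QuadraticMap.linMulLin (LinearMap.fst K K K) (LinearMap.snd K K K)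

/-- The binary form `a x² + b x y + c y²`. -/
def binaryForm {K : Type*} [Field K] (a b c : K) : QuadraticForm K (K × K) :=
  a • QuadraticMap.linMulLin (LinearMap.fst K K K) (LinearMap.fst K K K) +
    b • QuadraticMap.linMulLin (LinearMap.fst K K K) (LinearMap.snd K K K) +
    c • QuadraticMap.linMulLin (LinearMap.snd K K K) (LinearMap.snd K K K)

/-- A form is of `+`-type if it is isomorphic to `x₁x₂ + ⋯ + x₂ₖ₋₁x₂ₖ` for some `k`. -/
def IsPlusType {K M : Type*} [Field K] [AddCommGroup M] [Module K M]
    (Q : QuadraticForm K M) : Prop :=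
  ∃ k : ℕ, QuadraticMap.Equivalent Q (splitForm K k)

/-- A form is of `-`-type if it is isomorphic to the sum of some `x₁x₂ + ⋯ + x₂ₖ₋₁x₂ₖ` and the
binary form `x² - e y²` with `e` a non-square (characteristic not `2`), respectively
`x² + x y + e y²` with `t² + t + e` without roots (characteristic `2`). -/
def IsMinusType {K M : Type*} [Field K] [AddCommGroup M] [Module K M]
    (Q : QuadraticForm K M) : Prop :=
  ∃ (k : ℕ) (e : K),
    (ringChar K ≠ 2 ∧ ¬ IsSquare e ∧
      QuadraticMap.Equivalent Q ((splitForm K k).prod (binaryForm 1 0 (-e)))) ∨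
    (ringChar K = 2 ∧ (∀ t : K, t ^ 2 + t + e ≠ 0) ∧
      QuadraticMap.Equivalent Q ((splitForm K k).prod (binaryForm 1 1 e)))

/-- A form is of type `ε`, with `ε = 1` for `+`-type and `ε = -1` for `-`-type. -/
def IsOfType {K M : Type*} [Field K] [AddCommGroup M] [Module K M]
    (Q : QuadraticForm K M) (ε : ℤ) : Prop :=
  (ε = 1 ∧ IsPlusType Q) ∨ (ε = -1 ∧ IsMinusType Q)

end QuadraticForm

/-!
The order of `Iso(V, U)` is computed by splitting hyperbolic planes off `U`, in every characteristic
at once. The group `Iso(V, U)` contains the reflections in the non-singular vectors of `U` and the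
Siegel transformations attached to pairs of vectors of `U`, and the stabilizer in it of a vector `v`
is `Iso(V, U ∩ v^⊥)` (`mem_isometryGroup_cut`), because the orthogonal complement of `U ∩ v^⊥` is
`U^⊥ + ⟨v⟩`. Working with all of `V`, rather than with the isometries of `U`, is what makes odd
dimension in characteristic two behave like the other cases: the reflection in the radical of
`B|_U` is trivial on `U` but not on `V`.

If `U` has a non-zero singular vector `e`, it lies in a hyperbolic pair `(e, f)`. Reflections act
transitively on the non-zero singular vectors of `U`, and Siegel transformations act transitively
on the partners of `e`, which are parametrized by `U' = U ∩ ⟨e, f⟩^⊥`. With `N(U)` the number of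
zeros of `Q` on `U` this gives (`IsHyperbolicPair.card_isometryGroup`,
`IsHyperbolicPair.numZeros_eq`)

  `|Iso(V, U)| = (N(U) - 1) * |U'| * |Iso(V, U')|`,  `N(U) = q * N(U') + (q - 1) * |U'|`.

The second equation shows that in even dimension `N` determines, and is determined by, the type
`ε`. Hence the complement `U'` needs no classification: the induction in even dimension runs over
spaces with the value of `N` that belongs to `ε`, which is computed for the model forms in
`numZeros_of_isOfType`. In odd dimension `N(U) = q ^ (dim U - 1)` holds always.

As every form of dimension at least three has a non-zero singular vector, the recursion ends in
dimension zero (trivial group), in dimension one (identity and reflection), or with an anisotropic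
plane. On such a plane reflections act transitively on the vectors of each non-zero value, the
stabilizers are groups of the dimension-one case, and all values are attained; so the order is
`2 * (q ^ 2 - 1) / (q - 1)` (`card_isometryGroup_of_anisotropic_plane`).
-/

namespace VirtualQuadraticSpace

open QuadraticMap Module

variable {K V : Type*} [Field K] [AddCommGroup V] [Module K V] (S : VirtualQuadraticSpace K V)

/-! ### Virtual quadratic spaces and orthogonal complements -/

/-- The virtual quadratic space `(V, Q, U ∩ v^⊥)` obtained from `(V, Q, U)`. -/
def cut (v : V) : VirtualQuadraticSpace K V where
  form := S.form
  subspace := S.subspace ⊓ (S.form.polarBilin v).ker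
  separating := S.separating

@[simp] lemma cut_form (v : V) : (S.cut v).form = S.form := rfl

lemma mem_cut_subspace {v x : V} :
    x ∈ (S.cut v).subspace ↔ x ∈ S.subspace ∧ polar S.form v x = 0 := by
  simp [cut]

lemma cut_subspace_le (v : V) : (S.cut v).subspace ≤ S.subspace := inf_le_left

instance finiteDimensional_cut [FiniteDimensional K S.subspace] (v : V) :
    FiniteDimensional K (S.cut v).subspace :=
  Submodule.finiteDimensional_of_le (S.cut_subspace_le v)

lemma mem_perp {x : V} : x ∈ S.perp ↔ ∀ u ∈ S.subspace, polar S.form u x = 0 := by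
  simp [perp]

lemma isNondegenerate_iff : S.IsNondegenerate ↔
    ∀ v ∈ S.subspace, S.form v = 0 → (∀ u ∈ S.subspace, polar S.form v u = 0) → v = 0 := by
  simp only [IsNondegenerate, Submodule.eq_bot_iff, mem_radical_iff', subform, restrict_apply,
    Subtype.forall, Submodule.coe_add, Submodule.mk_eq_zero, and_imp]
  refine forall₂_congr fun v _ => forall_congr' fun h0 => imp_congr_left ?_
  refine forall₂_congr fun u _ => ?_
  simp [polar, h0, sub_eq_zero]

variable {S}

lemma eq_zero_of_polar_eq_zero {x : V} (h : ∀ y, polar S.form x y = 0) : x = 0 :=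
  S.separating x h

lemma IsNondegenerate.exists_polar_ne_zero (hS : S.IsNondegenerate) {e : V}
    (he : e ∈ S.subspace) (he0 : e ≠ 0) (hQ : S.form e = 0) :
    ∃ u ∈ S.subspace, polar S.form e u ≠ 0 := by
  by_contra! h
  exact he0 (S.isNondegenerate_iff.1 hS e he hQ h)

/-- Enlarging `U ∩ v^⊥` to `U` costs exactly the line of `v` on the level of orthogonal
complements: two linear forms on `U`, the second vanishing on the kernel of the first, are
proportional. -/
lemma mem_perp_cut {v x : V} :
    x ∈ (S.cut v).perp ↔ ∃ a : K, x - a • v ∈ S.perp := by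
  constructor
  · intro hx
    have h : (S.form.polarBilin v ∘ₗ S.subspace.subtype).ker ≤
        (S.form.polarBilin x ∘ₗ S.subspace.subtype).ker := by
      rintro ⟨u, hu⟩ h
      have := (mem_perp _).1 hx u ((mem_cut_subspace _).2 ⟨hu, by simpa using h⟩)
      rw [polar_comm] at this
      simpa using this
    have h2 := mem_span_of_iInf_ker_le_ker (𝕜 := K)
      (L := fun _ : Unit => S.form.polarBilin v ∘ₗ S.subspace.subtype)
      (K := S.form.polarBilin x ∘ₗ S.subspace.subtype) (by simpa using h)
    rw [Set.range_const, Submodule.mem_span_singleton] at h2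
    obtain ⟨a, ha⟩ := h2
    refine ⟨a, (mem_perp _).2 fun u hu => ?_⟩
    have := LinearMap.congr_fun ha ⟨u, hu⟩
    simp only [LinearMap.smul_apply, LinearMap.comp_apply, Submodule.subtype_apply,
      polarBilin_apply_apply] at this
    rw [polar_sub_right, polar_smul_right, polar_comm _ u x, polar_comm _ u v, ← this, sub_self]
  · rintro ⟨a, ha⟩
    refine (mem_perp _).2 fun u hu => ?_
    obtain ⟨hu, huv⟩ := (mem_cut_subspace _).1 hu
    have := (mem_perp _).1 ha u hu
    rw [polar_sub_right, polar_smul_right, polar_comm _ u v, huv, smul_zero, sub_zero] at this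
    exact this

/-- `U^⊥⊥ = U` for finite-dimensional `U`, although `V` may have infinite dimension. -/
lemma mem_subspace_of_forall_mem_perp [FiniteDimensional K S.subspace] {z : V}
    (hz : ∀ x ∈ S.perp, polar S.form z x = 0) : z ∈ S.subspace := by
  let b := Module.finBasis K S.subspace
  have h := mem_span_of_iInf_ker_le_ker (𝕜 := K)
    (L := fun i => S.form.polarBilin (b i : V)) (K := S.form.polarBilin z) (by
      intro x hx
      rw [Submodule.mem_iInf] at hx
      refine hz x ((mem_perp _).2 fun u hu => ?_)
      have : S.subspace ≤ (S.form.polarBilin.flip x).ker := by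
        have h3 : (S.form.polarBilin.flip x ∘ₗ S.subspace.subtype) = 0 :=
          b.ext fun i => by simpa using hx i
        intro u hu
        simpa using LinearMap.congr_fun h3 ⟨u, hu⟩
      simpa using this hu)
  rw [Set.range_comp' , Submodule.span_image] at h
  obtain ⟨y, hy, hyz⟩ := h
  have hyU : y ∈ S.subspace := by
    refine Submodule.span_le.2 ?_ hy
    rintro _ ⟨i, rfl⟩
    exact (b i).2
  have : z - y = 0 := eq_zero_of_polar_eq_zero (S := S) fun x => by
    have := LinearMap.congr_fun hyz x
    simp only [polarBilin_apply_apply] at this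
    rw [polar_sub_left, this, sub_self]
  rwa [sub_eq_zero.1 this]

/-! ### Isometries: orbits and stabilizers, reflections, Siegel transformations -/

lemma polar_apply_apply {f : V ≃ₗ[K] V} (hf : f ∈ S.isometryGroup) (x y : V) :
    polar S.form (f x) (f y) = polar S.form x y := by
  simp only [polar, ← map_add, hf.1]

/-- An isometry that fixes `U^⊥` moves every vector by an element of `U`. -/
lemma apply_sub_self_mem [FiniteDimensional K S.subspace] {f : V ≃ₗ[K] V}
    (hf : f ∈ S.isometryGroup) (v : V) : f v - v ∈ S.subspace := by
  refine mem_subspace_of_forall_mem_perp fun x hx => ?_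
  have := polar_apply_apply hf v x
  rw [hf.2 x hx] at this
  rw [polar_sub_left, this, sub_self]

/-- The isometries of `(V, U)` that fix `v` are those of `(V, U ∩ v^⊥)`. -/
lemma mem_isometryGroup_cut {f : V ≃ₗ[K] V} {v : V} :
    f ∈ (S.cut v).isometryGroup ↔ f ∈ S.isometryGroup ∧ f v = v := by
  constructor
  · intro hf
    refine ⟨⟨hf.1, fun w hw => hf.2 w (mem_perp_cut.2 ⟨0, by simpa using hw⟩)⟩,
      hf.2 v (mem_perp_cut.2 ⟨1, by simp⟩)⟩
  · rintro ⟨hf, hv⟩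
    refine ⟨hf.1, fun w hw => ?_⟩
    obtain ⟨a, ha⟩ := mem_perp_cut.1 hw
    have := hf.2 _ ha
    rwa [map_sub, map_smul, hv, sub_left_inj] at this

variable (S) in
/-- The orbit–stabilizer formula, the stabilizer of `v` being `Iso(V, U ∩ v^⊥)`. -/
lemma card_isometryGroup_eq_mul (v : V) {O : Set V}
    (hO : ∀ w, w ∈ O ↔ ∃ f ∈ S.isometryGroup, f v = w) :
    Nat.card S.isometryGroup = O.ncard * Nat.card (S.cut v).isometryGroup := by
  rw [← Subgroup.index_mul_card (MulAction.stabilizer S.isometryGroup v),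
    MulAction.index_stabilizer]
  congr 1
  · congr 1
    ext w
    rw [hO, MulAction.mem_orbit_iff]
    simp [Subgroup.smul_def]
  · refine Nat.card_congr
      { toFun := fun g => ⟨g.1.1, mem_isometryGroup_cut.2 ⟨g.1.2, g.2⟩⟩
        invFun := fun g => ⟨⟨g.1, (mem_isometryGroup_cut.1 g.2).1⟩, (mem_isometryGroup_cut.1 g.2).2⟩
        left_inv := fun _ => rfl
        right_inv := fun _ => rfl }

/-- The reflection in a vector of `U` on which `Q` does not vanish. -/
lemma exists_reflection {x : V} (hx : x ∈ S.subspace) (hQ : S.form x ≠ 0) :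
    ∃ f ∈ S.isometryGroup, ∀ v, f v = v - ((S.form x)⁻¹ * polar S.form x v) • x := by
  have h2 : ((S.form x)⁻¹ • S.form.polarBilin x) x = 2 := by
    simp only [LinearMap.smul_apply, polarBilin_apply_apply, polar_self, nsmul_eq_mul, smul_eq_mul]
    field_simp
    norm_num
  have h : ∀ v, Module.reflection h2 v = v - ((S.form x)⁻¹ * polar S.form x v) • x := by
    intro v
    simp [Module.reflection_apply]
  refine ⟨Module.reflection h2, ⟨fun v => ?_, fun w hw => ?_⟩, h⟩
  · rw [h, sub_eq_add_neg, QuadraticMap.map_add S.form, ← neg_smul, QuadraticMap.map_smul,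
      polar_smul_right,
      polar_comm _ v x]
    simp only [smul_eq_mul]
    field_simp
    ring
  · rw [h, (mem_perp _).1 hw x hx]
    simp

/-- Two vectors of equal value of `Q` whose difference lies in `U` and is not singular are
exchanged by a reflection. -/
lemma exists_apply_eq_of_form_sub_ne_zero {v w : V} (h : w - v ∈ S.subspace)
    (hvw : S.form v = S.form w) (hQ : S.form (w - v) ≠ 0) : ∃ f ∈ S.isometryGroup, f v = w := by
  obtain ⟨f, hf, hfv⟩ := exists_reflection h hQ
  refine ⟨f, hf, ?_⟩
  have : polar S.form (w - v) v = - S.form (w - v) := by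
    have h1 : S.form w = S.form (w - v) + S.form v + polar S.form (w - v) v := by
      rw [← QuadraticMap.map_add S.form, sub_add_cancel]
    linear_combination -hvw - h1
  rw [hfv, this, mul_neg, inv_mul_cancel₀ hQ]
  module

/-- The Siegel transformation attached to a singular vector `e` and a vector `y` orthogonal
to `e`. -/
def siegelMap (Q : QuadraticForm K V) (e y : V) : V →ₗ[K] V :=
  LinearMap.id + (Q.polarBilin e).smulRight y - (Q.polarBilin y).smulRight e
    - Q y • (Q.polarBilin e).smulRight e

lemma siegelMap_apply (Q : QuadraticForm K V) (e y x : V) :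
    siegelMap Q e y x = x + polar Q e x • y - polar Q y x • e - (Q y * polar Q e x) • e := by
  simp [siegelMap, mul_smul]

lemma siegelMap_siegelMap_neg {Q : QuadraticForm K V} {e y : V} (he : Q e = 0)
    (hey : polar Q e y = 0) (x : V) : siegelMap Q e y (siegelMap Q e (-y) x) = x := by
  have hye : polar Q y e = 0 := by rw [polar_comm, hey]
  have hee : polar Q e e = 0 := by rw [polar_self, he, smul_zero]
  simp only [siegelMap_apply, polar_add_right, polar_sub_right, polar_smul_right, polar_neg_right,
    polar_neg_left, QuadraticMap.map_neg, polar_self, hee, hey, hye, smul_eq_mul, nsmul_eq_mul]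
  module

lemma form_siegelMap {Q : QuadraticForm K V} {e y : V} (he : Q e = 0)
    (hey : polar Q e y = 0) (x : V) : Q (siegelMap Q e y x) = Q x := by
  have hye : polar Q y e = 0 := by rw [polar_comm, hey]
  have hee : polar Q e e = 0 := by rw [polar_self, he, smul_zero]
  simp only [siegelMap_apply, sub_eq_add_neg, QuadraticMap.map_add Q, QuadraticMap.map_neg,
    QuadraticMap.map_smul, polar_add_left, polar_neg_left, polar_smul_left,
    polar_smul_right, polar_neg_right, hee, hye, he, smul_eq_mul, polar_comm Q x e,
    polar_comm Q x y]
  ring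

/-- Vectors `v` and `v + z` of equal value of `Q`, with `z ∈ U` orthogonal to the singular vector
`e ∈ U` and `B(e, v) = 1`, are conjugate under the stabilizer of `e`. -/
lemma exists_apply_eq_of_singular {e v z : V} (he : e ∈ S.subspace) (hQe : S.form e = 0)
    (hev : polar S.form e v = 1) (hz : z ∈ S.subspace) (hez : polar S.form e z = 0)
    (hQ : S.form (v + z) = S.form v) : ∃ f ∈ (S.cut e).isometryGroup, f v = v + z := by
  have hze : polar S.form z e = 0 := by rw [polar_comm, hez]
  have hee : polar S.form e e = 0 := by rw [polar_self, hQe, smul_zero]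
  refine ⟨LinearEquiv.ofLinearMap (siegelMap S.form e z) (siegelMap S.form e (-z))
    (LinearMap.ext fun x => siegelMap_siegelMap_neg hQe hez x)
    (LinearMap.ext fun x => ?_), mem_isometryGroup_cut.2 ⟨⟨fun x => ?_, fun w hw => ?_⟩, ?_⟩, ?_⟩
  · simpa using siegelMap_siegelMap_neg (y := -z) hQe (by simpa using hez) x
  · exact form_siegelMap hQe hez x
  · simp [siegelMap_apply, (mem_perp _).1 hw e he, (mem_perp _).1 hw z hz]
  · simp [siegelMap_apply, hze, hee]
  · rw [QuadraticMap.map_add S.form, polar_comm] at hQ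
    have : polar S.form z v = - S.form z := by linear_combination hQ
    simp [siegelMap_apply, hev, this]

/-! ### Splitting off a hyperbolic plane -/

/-- A hyperbolic pair in `U`. -/
structure IsHyperbolicPair (S : VirtualQuadraticSpace K V) (e f : V) : Prop where
  left_mem : e ∈ S.subspace
  right_mem : f ∈ S.subspace
  form_left : S.form e = 0
  form_right : S.form f = 0
  polar_eq_one : polar S.form e f = 1

lemma IsNondegenerate.exists_isHyperbolicPair (hS : S.IsNondegenerate) {e : V}
    (he : e ∈ S.subspace) (he0 : e ≠ 0) (hQ : S.form e = 0) :
    ∃ f, S.IsHyperbolicPair e f := by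
  obtain ⟨u, hu, hB⟩ := hS.exists_polar_ne_zero he he0 hQ
  set b := polar S.form e u with hb
  have hee : polar S.form e e = 0 := by rw [polar_self, hQ, smul_zero]
  have hue : polar S.form u e = b := by rw [polar_comm]
  refine ⟨b⁻¹ • u - (b⁻¹ ^ 2 * S.form u) • e, he, ?_, hQ, ?_, ?_⟩
  · exact sub_mem (S.subspace.smul_mem _ hu) (S.subspace.smul_mem _ he)
  · simp only [sub_eq_add_neg, QuadraticMap.map_add S.form, QuadraticMap.map_neg,
      QuadraticMap.map_smul, polar_neg_right, polar_smul_left, polar_smul_right, hue, hQ,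
      smul_eq_mul]
    field_simp
    ring
  · rw [polar_sub_right, polar_smul_right, polar_smul_right, hee, ← hb]
    simp [hB]

namespace IsHyperbolicPair

variable {e f : V} (h : S.IsHyperbolicPair e f)
include h

lemma left_ne_zero : e ≠ 0 := by
  rintro rfl
  simpa using h.polar_eq_one

lemma polar_left_self : polar S.form e e = 0 := by rw [polar_self, h.form_left, smul_zero]

lemma polar_right_self : polar S.form f f = 0 := by rw [polar_self, h.form_right, smul_zero]

lemma polar_comm_eq_one : polar S.form f e = 1 := by rw [polar_comm, h.polar_eq_one]

omit h in
lemma mem_cut_cut {x : V} : x ∈ ((S.cut e).cut f).subspace ↔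
    x ∈ S.subspace ∧ polar S.form e x = 0 ∧ polar S.form f x = 0 := by
  rw [mem_cut_subspace, mem_cut_subspace, and_assoc, cut_form]

lemma form_add (a b : K) {u : V} (hu : u ∈ ((S.cut e).cut f).subspace) :
    S.form (a • e + b • f + u) = a * b + S.form u := by
  obtain ⟨-, hu1, hu2⟩ := mem_cut_cut.1 hu
  simp only [QuadraticMap.map_add S.form, QuadraticMap.map_smul, polar_add_left, polar_smul_left,
    polar_smul_right, h.form_left, h.form_right, h.polar_eq_one, hu1, hu2, smul_eq_mul]
  ring

/-- The orthogonal decomposition of `U` into the plane of a hyperbolic pair and its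
complement in `U`. -/
noncomputable def decomposition : ((K × K) × ((S.cut e).cut f).subspace) ≃ₗ[K] S.subspace :=
  LinearEquiv.ofBijective
    (LinearMap.codRestrict S.subspace
      (((LinearMap.toSpanSingleton K V e).coprod (LinearMap.toSpanSingleton K V f)).coprod
        ((S.cut e).cut f).subspace.subtype)
      (by
        rintro ⟨⟨a, b⟩, u, hu⟩
        exact add_mem (add_mem (S.subspace.smul_mem _ h.left_mem)
          (S.subspace.smul_mem _ h.right_mem)) (mem_cut_cut.1 hu).1))
    (by
      constructor
      · rw [injective_iff_map_eq_zero]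
        rintro ⟨⟨a, b⟩, u, hu⟩ hx
        obtain ⟨-, hu1, hu2⟩ := mem_cut_cut.1 hu
        replace hx : a • e + b • f + u = 0 := congrArg Subtype.val hx
        have h1 := congrArg (polar S.form e) hx
        have h2 := congrArg (polar S.form f) hx
        simp only [polar_add_right, polar_smul_right, h.polar_left_self, h.polar_right_self,
          h.polar_eq_one, h.polar_comm_eq_one, hu1, hu2, polar_zero_right, smul_eq_mul, mul_zero,
          mul_one, add_zero, zero_add] at h1 h2
        subst h1 h2
        simpa using hx
      · rintro ⟨x, hx⟩
        refine ⟨((polar S.form f x, polar S.form e x),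
          ⟨x - polar S.form f x • e - polar S.form e x • f, mem_cut_cut.2 ⟨?_, ?_, ?_⟩⟩), ?_⟩
        · exact sub_mem (sub_mem hx (S.subspace.smul_mem _ h.left_mem))
            (S.subspace.smul_mem _ h.right_mem)
        · simp [polar_sub_right, polar_smul_right, h.polar_left_self, h.polar_eq_one]
        · simp [polar_sub_right, polar_smul_right, h.polar_right_self, h.polar_comm_eq_one]
        · apply Subtype.ext
          simp)

lemma coe_decomposition (p : (K × K) × ((S.cut e).cut f).subspace) :
    (h.decomposition p : V) = p.1.1 • e + p.1.2 • f + p.2 := rfl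

lemma finrank_eq [FiniteDimensional K S.subspace] :
    finrank K S.subspace = finrank K ((S.cut e).cut f).subspace + 2 := by
  rw [← h.decomposition.finrank_eq, finrank_prod, finrank_prod, finrank_self]
  ring

lemma isNondegenerate_cut_cut (hS : S.IsNondegenerate) :
    ((S.cut e).cut f).IsNondegenerate := by
  rw [isNondegenerate_iff] at hS ⊢
  intro v hv hQ hB
  obtain ⟨hvU, hv1, hv2⟩ := mem_cut_cut.1 hv
  refine hS v hvU hQ fun u hu => ?_
  obtain ⟨p, hp⟩ := h.decomposition.surjective ⟨u, hu⟩
  obtain rfl : p.1.1 • e + p.1.2 • f + (p.2 : V) = u := by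
    rw [← h.coe_decomposition, hp]
  have h3 := hB _ p.2.2
  rw [cut_form, cut_form] at h3
  rw [polar_add_right, polar_add_right, polar_smul_right, polar_smul_right, polar_comm _ v e,
    polar_comm _ v f, hv1, hv2, h3]
  simp

/-- The partners of `e` in a hyperbolic pair are parametrized by `U ∩ ⟨e, f⟩^⊥`. -/
lemma ncard_partners :
    {w | S.IsHyperbolicPair e w}.ncard = Nat.card ((S.cut e).cut f).subspace := by
  rw [← Nat.card_coe_set_eq]
  symm
  refine Nat.card_eq_of_bijective
    (fun u : ((S.cut e).cut f).subspace =>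
      (⟨(-S.form u) • e + (1 : K) • f + u, ?_⟩ : {w | S.IsHyperbolicPair e w})) ⟨?_, ?_⟩
  · obtain ⟨hu, hu1, hu2⟩ := mem_cut_cut.1 u.2
    refine ⟨h.left_mem, add_mem (add_mem (S.subspace.smul_mem _ h.left_mem)
      (S.subspace.smul_mem _ h.right_mem)) hu, h.form_left, ?_, ?_⟩
    · rw [h.form_add _ _ u.2]
      ring
    · simp [polar_add_right, polar_smul_right, polar_neg_right, h.polar_left_self, h.polar_eq_one,
        hu1]
  · intro u u' huu
    have h1 := congrArg Subtype.val huu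
    have := h.decomposition.injective (show h.decomposition ((-S.form u, 1), u) =
      h.decomposition ((-S.form u', 1), u') from Subtype.ext h1)
    exact (Prod.ext_iff.1 this).2
  · rintro ⟨w, hw⟩
    obtain ⟨⟨⟨a, b⟩, u⟩, hp⟩ := h.decomposition.surjective ⟨w, hw.right_mem⟩
    replace hp : a • e + b • f + (u : V) = w := congrArg Subtype.val hp
    obtain ⟨hu, hu1, hu2⟩ := mem_cut_cut.1 u.2
    have hb : b = 1 := by
      have := hw.polar_eq_one
      rw [← hp] at this
      simpa [polar_add_right, polar_smul_right, h.polar_left_self, h.polar_eq_one, hu1] using this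
    have ha : a = -S.form u := by
      have := hw.form_right
      rw [← hp, h.form_add _ _ u.2, hb] at this
      linear_combination this
    exact ⟨u, Subtype.ext (by simp only [← hp, ha, hb])⟩

/-- The stabilizer of `e` permutes its partners in hyperbolic pairs transitively. -/
lemma card_isometryGroup_cut [FiniteDimensional K S.subspace] :
    Nat.card (S.cut e).isometryGroup =
      Nat.card ((S.cut e).cut f).subspace * Nat.card ((S.cut e).cut f).isometryGroup := by
  rw [← h.ncard_partners]
  refine card_isometryGroup_eq_mul _ f fun w => ⟨fun hw => ?_, ?_⟩
  · have := exists_apply_eq_of_singular (v := f) (z := w - f) h.left_mem h.form_left h.polar_eq_one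
      (sub_mem hw.right_mem h.right_mem)
      (by rw [polar_sub_right, hw.polar_eq_one, h.polar_eq_one, sub_self])
      (by rw [add_sub_cancel, hw.form_right, h.form_right])
    rwa [add_sub_cancel] at this
  · rintro ⟨g, hg, rfl⟩
    obtain ⟨hg, hge⟩ := mem_isometryGroup_cut.1 hg
    refine ⟨h.left_mem, ?_, h.form_left, ?_, ?_⟩
    · simpa using add_mem (apply_sub_self_mem hg f) h.right_mem
    · rw [hg.1, h.form_right]
    · rw [← h.polar_eq_one, ← polar_apply_apply hg e f, hge]

end IsHyperbolicPair

/-- `Iso(V, U)` permutes the non-zero singular vectors of `U` transitively. Two of them that are not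
orthogonal are exchanged by a reflection; otherwise a third singular vector, orthogonal to
neither, links them. -/
lemma IsNondegenerate.exists_apply_eq (hS : S.IsNondegenerate) {e e' : V}
    (he : e ∈ S.subspace) (he0 : e ≠ 0) (hQ : S.form e = 0)
    (he' : e' ∈ S.subspace) (he0' : e' ≠ 0) (hQ' : S.form e' = 0) :
    ∃ f ∈ S.isometryGroup, f e = e' := by
  have key : ∀ x ∈ S.subspace, ∀ y ∈ S.subspace, S.form x = 0 → S.form y = 0 →
      polar S.form x y ≠ 0 → ∃ f ∈ S.isometryGroup, f x = y := by
    intro x hx y hy hQx hQy hB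
    refine exists_apply_eq_of_form_sub_ne_zero (sub_mem hy hx) (hQx.trans hQy.symm) ?_
    rw [sub_eq_add_neg, QuadraticMap.map_add S.form, QuadraticMap.map_neg, polar_neg_right, hQx,
      hQy, polar_comm]
    simpa using hB
  obtain ⟨x, hx, hx1, hx2⟩ : ∃ x ∈ S.subspace, polar S.form e x ≠ 0 ∧ polar S.form e' x ≠ 0 := by
    obtain ⟨x, hx, hxe⟩ := hS.exists_polar_ne_zero he he0 hQ
    obtain ⟨y, hy, hye⟩ := hS.exists_polar_ne_zero he' he0' hQ'
    by_cases h1 : polar S.form e' x = 0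
    · by_cases h2 : polar S.form e y = 0
      · refine ⟨x + y, add_mem hx hy, ?_, ?_⟩
        · rwa [polar_add_right, h2, add_zero]
        · rwa [polar_add_right, h1, zero_add]
      · exact ⟨y, hy, h2, hye⟩
    · exact ⟨x, hx, hxe, h1⟩
  by_cases hB : polar S.form e e' = 0
  · have hee : polar S.form e e = 0 := by rw [polar_self, hQ, smul_zero]
    have hee' : polar S.form e' e = 0 := by rw [polar_comm, hB]
    set y := x - (S.form x / polar S.form e x) • e with hy
    have hyU : y ∈ S.subspace := sub_mem hx (S.subspace.smul_mem _ he)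
    have hQy : S.form y = 0 := by
      rw [hy, sub_eq_add_neg, QuadraticMap.map_add S.form, QuadraticMap.map_neg, polar_neg_right,
        QuadraticMap.map_smul, polar_smul_right, hQ, polar_comm _ x e]
      simp [hx1]
    have h1 : polar S.form e y = polar S.form e x := by
      rw [hy, polar_sub_right, polar_smul_right, hee, smul_zero, sub_zero]
    have h2 : polar S.form e' y = polar S.form e' x := by
      rw [hy, polar_sub_right, polar_smul_right, hee', smul_zero, sub_zero]
    obtain ⟨f, hf, hfe⟩ := key e he y hyU hQ hQy (by rwa [h1])
    obtain ⟨g, hg, hge⟩ := key y hyU e' he' hQy hQ' (by rwa [polar_comm, h2])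
    exact ⟨g * f, mul_mem hg hf, by rw [LinearEquiv.mul_apply, hfe, hge]⟩
  · exact key e he e' he' hQ hQ' hB

/-! ### The number of singular vectors -/

/-- The number of vectors of `U`, zero included, on which `Q` vanishes. -/
noncomputable def numZeros (S : VirtualQuadraticSpace K V) : ℕ :=
  Nat.card {x : S.subspace // S.form x = 0}

lemma ncard_singular [Finite S.subspace] :
    {w | w ∈ S.subspace ∧ w ≠ 0 ∧ S.form w = 0}.ncard = S.numZeros - 1 := by
  have h1 : S.numZeros = {w | w ∈ S.subspace ∧ S.form w = 0}.ncard := by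
    rw [← Nat.card_coe_set_eq]
    exact Nat.card_congr (Equiv.subtypeSubtypeEquivSubtypeInter (· ∈ S.subspace)
      (fun w => S.form w = 0))
  have h2 : {w | w ∈ S.subspace ∧ w ≠ 0 ∧ S.form w = 0} =
      {w | w ∈ S.subspace ∧ S.form w = 0} \ {0} := by
    ext w
    simp
    tauto
  rw [h1, h2, Set.ncard_sdiff_singleton_of_mem (by simp)]

lemma exists_singular_iff [Finite S.subspace] :
    (∃ e ∈ S.subspace, e ≠ 0 ∧ S.form e = 0) ↔ 1 < S.numZeros := by
  rw [← Nat.sub_pos_iff_lt, ← ncard_singular, Set.ncard_pos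
    (Set.Finite.subset (Set.toFinite (S.subspace : Set V)) fun _ h => h.1)]
  rfl

/-- The recursion for the number of solutions when the form `xy` in new variables is added. For
`x ≠ 0` the value of `y` is determined, and for `x = 0` it is arbitrary. -/
lemma card_mul_add_eq_zero [Finite K] {A : Type*} [Finite A] (g : A → K) :
    (Nat.card {p : (K × K) × A // p.1.1 * p.1.2 + g p.2 = 0} : ℤ) =
      Nat.card K * Nat.card {a // g a = 0} + (Nat.card K - 1) * Nat.card A := by
  have h : Nat.card ((Kˣ × A) ⊕ (K × {a // g a = 0})) =
      Nat.card {p : (K × K) × A // p.1.1 * p.1.2 + g p.2 = 0} := by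
    refine Nat.card_eq_of_bijective (Sum.elim
      (fun p => ⟨((p.1, -(p.1 : K)⁻¹ * g p.2), p.2), by simp⟩)
      (fun p => ⟨((0, p.1), p.2), by simp [p.2.2]⟩)) ⟨?_, ?_⟩
    · rintro (⟨x, a⟩ | ⟨y, a, ha⟩) (⟨x', a'⟩ | ⟨y', a', ha'⟩) h
      · simp only [Sum.elim_inl, Subtype.mk.injEq, Prod.mk.injEq, Units.val_inj] at h
        rw [h.1.1, h.2]
      · simp at h
      · simp only [Sum.elim_inl, Sum.elim_inr, Subtype.mk.injEq, Prod.mk.injEq] at h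
        exact absurd h.1.1.symm x'.ne_zero
      · simp only [Sum.elim_inr, Subtype.mk.injEq, Prod.mk.injEq] at h
        obtain ⟨⟨-, rfl⟩, rfl⟩ := h
        rfl
    · rintro ⟨⟨⟨x, y⟩, a⟩, h⟩
      dsimp only at h
      by_cases hx : x = 0
      · subst hx
        exact ⟨Sum.inr (y, ⟨a, by simpa using h⟩), rfl⟩
      · refine ⟨Sum.inl (Units.mk0 x hx, a), ?_⟩
        have : y = -x⁻¹ * g a := by
          field_simp
          linear_combination h
        simp [this]
  rw [← h, Nat.card_sum, Nat.card_prod, Nat.card_prod, Nat.card_units]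
  push_cast [Nat.cast_sub (Nat.card_pos : 0 < Nat.card K)]
  ring

lemma card_subspace [Finite K] [FiniteDimensional K S.subspace] :
    Nat.card S.subspace = Nat.card K ^ finrank K S.subspace :=
  Module.natCard_eq_pow_finrank

lemma IsHyperbolicPair.numZeros_eq [Finite K] [FiniteDimensional K S.subspace] {e f : V}
    (h : S.IsHyperbolicPair e f) :
    (S.numZeros : ℤ) = Nat.card K * ((S.cut e).cut f).numZeros +
      (Nat.card K - 1) * (Nat.card K : ℤ) ^ finrank K ((S.cut e).cut f).subspace := by
  have : Finite ((S.cut e).cut f).subspace := Module.finite_of_finite K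
  have h1 := card_mul_add_eq_zero (fun u : ((S.cut e).cut f).subspace => S.form u)
  rw [card_subspace] at h1
  push_cast at h1
  rw [numZeros, numZeros, cut_form, cut_form, ← h1]
  congr 1
  refine (Nat.card_congr (Equiv.subtypeEquiv h.decomposition.toEquiv fun p => ?_)).symm
  rw [LinearEquiv.coe_toEquiv, h.coe_decomposition, h.form_add _ _ p.2.2]

/-- The recursion for the order of `Iso(V, U)`: the group is transitive on the hyperbolic pairs
of `U`, and the stabilizer of `(e, f)` is `Iso(V, U ∩ ⟨e, f⟩^⊥)`. -/
lemma IsHyperbolicPair.card_isometryGroup [Finite K] [FiniteDimensional K S.subspace] {e f : V}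
    (h : S.IsHyperbolicPair e f) (hS : S.IsNondegenerate) :
    (Nat.card S.isometryGroup : ℤ) = (S.numZeros - 1) *
      (Nat.card K : ℤ) ^ finrank K ((S.cut e).cut f).subspace *
        Nat.card ((S.cut e).cut f).isometryGroup := by
  have : Finite S.subspace := Module.finite_of_finite K
  have h1 : Nat.card S.isometryGroup = (S.numZeros - 1) * Nat.card (S.cut e).isometryGroup := by
    rw [← ncard_singular]
    refine card_isometryGroup_eq_mul _ e fun w => ⟨fun hw => ?_, ?_⟩
    · exact hS.exists_apply_eq h.left_mem h.left_ne_zero h.form_left hw.1 hw.2.1 hw.2.2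
    · rintro ⟨g, hg, rfl⟩
      refine ⟨?_, ?_, ?_⟩
      · simpa using add_mem (apply_sub_self_mem hg e) h.left_mem
      · simpa using h.left_ne_zero
      · rw [hg.1, h.form_left]
  have h2 : 1 < S.numZeros := exists_singular_iff.1 ⟨e, h.left_mem, h.left_ne_zero, h.form_left⟩
  rw [h1, h.card_isometryGroup_cut, card_subspace]
  push_cast [Nat.cast_sub h2.le]
  ring

/-! ### Dimensions zero, one and two, and the existence of singular vectors -/

lemma card_isometryGroup_of_finrank_eq_zero [FiniteDimensional K S.subspace]
    (h : finrank K S.subspace = 0) : Nat.card S.isometryGroup = 1 := by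
  have hbot : S.subspace = ⊥ := Submodule.finrank_eq_zero.1 h
  have : S.isometryGroup = ⊥ := by
    rw [Subgroup.eq_bot_iff_forall]
    intro f hf
    ext v
    refine hf.2 v ((mem_perp _).2 fun u hu => ?_)
    rw [hbot, Submodule.mem_bot] at hu
    rw [hu, polar_zero_left]
  rw [this, Subgroup.card_bot]

/-- In dimension one the group consists of the identity and the reflection: these are the only
possible images of a vector of `V` not orthogonal to `U`. -/
lemma card_isometryGroup_of_finrank_eq_one (h : finrank K S.subspace = 1) {w : V}
    (hw : w ∈ S.subspace) (hQ : S.form w ≠ 0) : Nat.card S.isometryGroup = 2 := by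
  have : FiniteDimensional K S.subspace := FiniteDimensional.of_finrank_pos (by omega)
  have hw0 : w ≠ 0 := by rintro rfl; simp at hQ
  have hspan : ∀ x ∈ S.subspace, ∃ c : K, c • w = x := fun x hx => by
    obtain ⟨c, hc⟩ := (finrank_eq_one_iff_of_nonzero' (⟨w, hw⟩ : S.subspace)
      (by simpa using hw0)).1 h ⟨x, hx⟩
    exact ⟨c, congrArg Subtype.val hc⟩
  obtain ⟨v, hv⟩ : ∃ v, polar S.form w v ≠ 0 := by
    by_contra! hc
    exact hw0 (eq_zero_of_polar_eq_zero hc)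
  obtain ⟨r, hr, hrv⟩ := exists_reflection hw hQ
  have hvr : v ≠ r v := by
    rw [hrv]
    intro h0
    have : ((S.form w)⁻¹ * polar S.form w v) • w = 0 := by
      simpa using (sub_eq_self.1 h0.symm)
    simp [hQ, hv, hw0] at this
  have hcut : Nat.card (S.cut v).isometryGroup = 1 := by
    refine card_isometryGroup_of_finrank_eq_zero (Submodule.finrank_eq_zero.2 ?_)
    rw [Submodule.eq_bot_iff]
    intro x hx
    obtain ⟨hx, hxv⟩ := (mem_cut_subspace _).1 hx
    obtain ⟨c, rfl⟩ := hspan x hx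
    rw [polar_smul_right, polar_comm, smul_eq_mul, mul_eq_zero, or_iff_left hv] at hxv
    rw [hxv, zero_smul]
  rw [S.card_isometryGroup_eq_mul v (O := {v, r v}), hcut, Set.ncard_pair hvr]
  intro x
  constructor
  · rintro (rfl | rfl)
    · exact ⟨1, one_mem _, rfl⟩
    · exact ⟨r, hr, rfl⟩
  · rintro ⟨g, hg, rfl⟩
    obtain ⟨c, hc⟩ := hspan _ (apply_sub_self_mem hg v)
    have hgv : g v = v + c • w := by rw [hc, add_sub_cancel]
    have h1 := hg.1 v
    rw [hgv, QuadraticMap.map_add S.form, QuadraticMap.map_smul, polar_smul_right,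
      polar_comm _ v w] at h1
    have h2 : c * (c * S.form w + polar S.form w v) = 0 := by
      simp only [smul_eq_mul] at h1
      linear_combination h1
    rcases mul_eq_zero.1 h2 with h3 | h3
    · left
      rw [hgv, h3, zero_smul, add_zero]
    · right
      have : c = -((S.form w)⁻¹ * polar S.form w v) := by
        field_simp
        linear_combination h3
      rw [Set.mem_singleton_iff, hgv, hrv, this]
      module

lemma finrank_le_finrank_cut_add_one [FiniteDimensional K S.subspace] (v : V) :
    finrank K S.subspace ≤ finrank K (S.cut v).subspace + 1 := by
  have h1 := LinearMap.finrank_range_add_finrank_ker (S.form.polarBilin v ∘ₗ S.subspace.subtype)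
  have h2 : finrank K (S.form.polarBilin v ∘ₗ S.subspace.subtype).range ≤ 1 := by
    simpa using Submodule.finrank_le (S.form.polarBilin v ∘ₗ S.subspace.subtype).range
  have h3 : finrank K (S.form.polarBilin v ∘ₗ S.subspace.subtype).ker ≤
      finrank K (S.cut v).subspace := by
    rw [← Submodule.finrank_map_subtype_eq S.subspace]
    refine Submodule.finrank_mono ?_
    rintro _ ⟨x, hx, rfl⟩
    exact (mem_cut_subspace _).2 ⟨x.2, by simpa using hx⟩
  omega

lemma exists_mem_ne_zero_of_finrank_pos (h : 0 < finrank K S.subspace) :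
    ∃ v ∈ S.subspace, v ≠ 0 := by
  by_contra! hc
  rw [(Submodule.eq_bot_iff _).2 hc, finrank_bot] at h
  exact lt_irrefl _ h

lemma exists_polar_eq_zero [FiniteDimensional K S.subspace] (v : V)
    (h : 2 ≤ finrank K S.subspace) : ∃ w ∈ S.subspace, w ≠ 0 ∧ polar S.form v w = 0 := by
  have := S.finrank_le_finrank_cut_add_one v
  obtain ⟨w, hw, hw0⟩ := exists_mem_ne_zero_of_finrank_pos (S := S.cut v) (by omega)
  obtain ⟨hw, hvw⟩ := (mem_cut_subspace _).1 hw
  exact ⟨w, hw, hw0, hvw⟩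

/-- In characteristic two, `Q` is additive on orthogonal vectors and every scalar is a square, so
two independent orthogonal vectors span a plane with a singular vector. -/
lemma exists_singular_of_ringChar_eq_two [Finite K] [FiniteDimensional K S.subspace]
    (hK : ringChar K = 2) {v : V} (hv : v ∈ S.subspace) (hv0 : v ≠ 0)
    (h : 2 ≤ finrank K (S.cut v).subspace) : ∃ e ∈ S.subspace, e ≠ 0 ∧ S.form e = 0 := by
  by_cases hQ : S.form v = 0
  · exact ⟨v, hv, hv0, hQ⟩
  obtain ⟨w, hw, hwv⟩ : ∃ w ∈ (S.cut v).subspace, w ∉ K ∙ v := by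
    by_contra! hc
    have := Submodule.finrank_mono hc
    rw [finrank_span_singleton hv0] at this
    omega
  obtain ⟨hw, hvw⟩ := (mem_cut_subspace _).1 hw
  obtain ⟨t, ht⟩ := FiniteField.isSquare_of_char_two hK (S.form w / S.form v)
  have : CharP K 2 := ringChar.of_eq hK
  refine ⟨w - t • v, sub_mem hw (S.subspace.smul_mem _ hv), ?_, ?_⟩
  · intro h0
    exact hwv (Submodule.mem_span_singleton.2 ⟨t, (sub_eq_zero.1 h0).symm⟩)
  · rw [sub_eq_add_neg, QuadraticMap.map_add S.form, QuadraticMap.map_neg, polar_neg_right,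
      QuadraticMap.map_smul, polar_smul_right, polar_comm, hvw, ← ht, smul_eq_mul,
      div_mul_cancel₀ _ hQ, CharTwo.add_self_eq_zero]
    simp

lemma exists_mul_sq_add_mul_sq_eq [Finite K] (hK : ringChar K ≠ 2) {a b : K} (ha : a ≠ 0)
    (hb : b ≠ 0) (c : K) : ∃ x y : K, a * x ^ 2 + b * y ^ 2 = c := by
  have := Fintype.ofFinite K
  obtain ⟨x, y, h⟩ := FiniteField.exists_root_sum_quadratic
    (f := Polynomial.C a * Polynomial.X ^ 2 + Polynomial.C 0 * Polynomial.X + Polynomial.C 0)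
    (g := Polynomial.C b * Polynomial.X ^ 2 + Polynomial.C 0 * Polynomial.X + Polynomial.C (-c))
    (Polynomial.degree_quadratic ha) (Polynomial.degree_quadratic hb)
    (FiniteField.odd_card_of_char_ne_two hK)
  refine ⟨x, y, ?_⟩
  simp at h
  linear_combination h

/-- Without a non-zero singular vector, `Q` takes every value as soon as `dim U ≥ 2`. -/
lemma exists_form_eq [Finite K] [FiniteDimensional K S.subspace] (h : 2 ≤ finrank K S.subspace)
    (hS : ∀ e ∈ S.subspace, S.form e = 0 → e = 0) (c : K) :
    ∃ x ∈ S.subspace, S.form x = c := by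
  obtain ⟨v, hv, hv0⟩ := exists_mem_ne_zero_of_finrank_pos (S := S) (by omega)
  have hQv : S.form v ≠ 0 := fun h0 => hv0 (hS v hv h0)
  by_cases hK : ringChar K = 2
  · obtain ⟨t, ht⟩ := FiniteField.isSquare_of_char_two hK (c / S.form v)
    refine ⟨t • v, S.subspace.smul_mem _ hv, ?_⟩
    rw [QuadraticMap.map_smul, ← ht, smul_eq_mul, div_mul_cancel₀ _ hQv]
  · obtain ⟨w, hw, hw0, hvw⟩ := exists_polar_eq_zero v h
    obtain ⟨x, y, hxy⟩ := exists_mul_sq_add_mul_sq_eq hK hQv (fun h0 => hw0 (hS w hw h0)) c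
    refine ⟨x • v + y • w, add_mem (S.subspace.smul_mem _ hv) (S.subspace.smul_mem _ hw), ?_⟩
    rw [QuadraticMap.map_add S.form, QuadraticMap.map_smul, QuadraticMap.map_smul, polar_smul_left,
      polar_smul_right, hvw, ← hxy]
    simp only [smul_eq_mul]
    ring

/-- A quadratic form of dimension at least three over a finite field has a non-zero zero. -/
lemma exists_singular_of_three_le_finrank [Finite K] [FiniteDimensional K S.subspace]
    (h : 3 ≤ finrank K S.subspace) : ∃ e ∈ S.subspace, e ≠ 0 ∧ S.form e = 0 := by
  obtain ⟨v, hv, hv0⟩ := exists_mem_ne_zero_of_finrank_pos (S := S) (by omega)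
  have hcut := S.finrank_le_finrank_cut_add_one v
  by_cases hK : ringChar K = 2
  · exact exists_singular_of_ringChar_eq_two hK hv hv0 (by omega)
  by_contra! hc
  have h2 : (2 : K) ≠ 0 := Ring.two_ne_zero hK
  have hQv : S.form v ≠ 0 := fun h0 => hc v hv hv0 h0
  -- `-Q(v)` is a value of `Q` on `U ∩ v^⊥`.
  obtain ⟨x, hx, hQx⟩ := exists_form_eq (S := S.cut v) (by omega)
    (fun e he h0 => by_contra fun he0 => hc e (S.cut_subspace_le v he) he0 h0) (-S.form v)
  obtain ⟨hx, hvx⟩ := (mem_cut_subspace _).1 hx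
  refine hc (v + x) (add_mem hv hx) (fun h0 => ?_) ?_
  · have := congrArg (polar S.form v) h0
    rw [polar_add_right, polar_self, hvx, polar_zero_right, nsmul_eq_mul, add_zero] at this
    simp [h2, hQv] at this
  · rw [cut_form] at hQx
    rw [QuadraticMap.map_add S.form, hvx, hQx]
    ring

lemma finrank_cut_eq_one [Finite K] (h : finrank K S.subspace = 2)
    (hS : ∀ e ∈ S.subspace, S.form e = 0 → e = 0) {v : V} (hv : v ∈ S.subspace) (hv0 : v ≠ 0) :
    finrank K (S.cut v).subspace = 1 := by
  have : FiniteDimensional K S.subspace := FiniteDimensional.of_finrank_pos (by omega)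
  have hcut := S.finrank_le_finrank_cut_add_one v
  refine le_antisymm ?_ (by omega)
  by_contra! h2
  by_cases hK : ringChar K = 2
  · obtain ⟨e, he, he0, hQe⟩ := exists_singular_of_ringChar_eq_two hK hv hv0 h2
    exact he0 (hS e he hQe)
  · have heq := Submodule.eq_of_le_of_finrank_le (S.cut_subspace_le v) (by omega)
    have hvv := ((mem_cut_subspace _).1 (heq.symm ▸ hv : v ∈ (S.cut v).subspace)).2
    rw [polar_self, nsmul_eq_mul, mul_eq_zero, or_iff_right] at hvv
    · exact hv0 (hS v hv hvv)
    · exact_mod_cast Ring.two_ne_zero hK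

/-- On an anisotropic plane the group is transitive on the vectors of given non-zero value, with
stabilizers of order two. Every value occurs, so that all `q - 1` non-zero values are taken
equally often by the `q ^ 2 - 1` non-zero vectors. -/
lemma card_isometryGroup_of_anisotropic_plane [Finite K] (h : finrank K S.subspace = 2)
    (hS : ∀ e ∈ S.subspace, S.form e = 0 → e = 0) :
    (Nat.card S.isometryGroup : ℤ) = 2 * (Nat.card K + 1) := by
  have hfd : FiniteDimensional K S.subspace := FiniteDimensional.of_finrank_pos (by omega)
  have hfin : Finite S.subspace := Module.finite_of_finite K
  have key : ∀ c : K, c ≠ 0 →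
      Nat.card S.isometryGroup = Nat.card {x : S.subspace // S.form x = c} * 2 := by
    intro c hc
    obtain ⟨v, hv, hQv⟩ := exists_form_eq h.ge hS c
    have hv0 : v ≠ 0 := by rintro rfl; exact hc (by simpa using hQv.symm)
    have hcut := finrank_cut_eq_one h hS hv hv0
    obtain ⟨w, hw, hw0⟩ := exists_mem_ne_zero_of_finrank_pos (S := S.cut v) (by omega)
    rw [S.card_isometryGroup_eq_mul v (O := {x | x ∈ S.subspace ∧ S.form x = c}),
      card_isometryGroup_of_finrank_eq_one hcut hw
        (fun h0 => hw0 (hS w (S.cut_subspace_le v hw) h0)),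
      ← Nat.card_coe_set_eq]
    · congr 1
      exact (Nat.card_congr (Equiv.subtypeSubtypeEquivSubtypeInter (· ∈ S.subspace)
        (fun w => S.form w = c))).symm
    · intro w
      constructor
      · rintro ⟨hw, hQw⟩
        by_cases hvw : w = v
        · exact ⟨1, one_mem _, hvw.symm⟩
        · refine exists_apply_eq_of_form_sub_ne_zero (sub_mem hw hv) (hQv.trans hQw.symm)
            fun h0 => hvw ?_
          exact sub_eq_zero.1 (hS _ (sub_mem hw hv) h0)
      · rintro ⟨g, hg, rfl⟩
        refine ⟨?_, by rw [hg.1, hQv]⟩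
        simpa using add_mem (apply_sub_self_mem hg v) hv
  have hzero : Nat.card {x : S.subspace // S.form x = 0} = 1 := by
    rw [Nat.card_eq_one_iff_unique]
    refine ⟨⟨fun x y => ?_⟩, ⟨⟨0, by simp⟩⟩⟩
    apply Subtype.ext
    apply Subtype.ext
    rw [hS _ x.1.2 x.2, hS _ y.1.2 y.2]
  classical
  have := Fintype.ofFinite K
  have hsum : Nat.card K ^ 2 = ∑ c : K, Nat.card {x : S.subspace // S.form x = c} := by
    rw [← h, ← card_subspace, ← Nat.card_sigma]
    exact (Nat.card_congr (Equiv.sigmaFiberEquiv fun x : S.subspace => S.form x)).symm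
  rw [← Finset.add_sum_erase _ _ (Finset.mem_univ (0 : K)), hzero] at hsum
  have hsum2 : (∑ c ∈ Finset.univ.erase (0 : K), Nat.card {x : S.subspace // S.form x = c}) * 2 =
      (Nat.card K - 1) * Nat.card S.isometryGroup := by
    rw [Finset.sum_mul, Finset.sum_congr rfl fun c hc => (key c (Finset.ne_of_mem_erase hc)).symm,
      Finset.sum_const, Finset.card_erase_of_mem (Finset.mem_univ _), Finset.card_univ,
      ← Nat.card_eq_fintype_card, smul_eq_mul]
  have hq : 1 < Nat.card K := Finite.one_lt_card
  have h3 : ((Nat.card K : ℤ) - 1) * Nat.card S.isometryGroup =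
      (Nat.card K - 1) * (2 * (Nat.card K + 1)) := by
    zify [hq.le] at hsum hsum2
    rw [← hsum2]
    linear_combination (-2) * hsum
  refine mul_left_cancel₀ ?_ h3
  have : (1 : ℤ) < Nat.card K := by exact_mod_cast hq
  omega

end VirtualQuadraticSpace

namespace QuadraticForm

variable {K : Type*} [Field K]

/-! ### The number of zeros of the model forms -/

lemma card_splitForm_add_eq_zero [Finite K] {A : Type*} [Finite A] (g : A → K) (k : ℕ) :
    (Nat.card K : ℤ) * Nat.card {p : (Fin k → K × K) × A // splitForm K k p.1 + g p.2 = 0} =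
      (Nat.card K : ℤ) ^ (k + 1) * Nat.card {a // g a = 0} +
        (Nat.card K : ℤ) ^ k * ((Nat.card K : ℤ) ^ k - 1) * Nat.card A := by
  induction k with
  | zero =>
    have : Nat.card {p : (Fin 0 → K × K) × A // splitForm K 0 p.1 + g p.2 = 0} =
        Nat.card {a // g a = 0} :=
      Nat.card_congr (Equiv.subtypeEquiv (Equiv.uniqueProd A (Fin 0 → K × K)) fun p => by
        simp [splitForm])
    rw [this]
    ring
  | succ k ih =>
    have h1 : Nat.card {p : (Fin (k + 1) → K × K) × A // splitForm K (k + 1) p.1 + g p.2 = 0} =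
        Nat.card {p : (K × K) × ((Fin k → K × K) × A) //
          p.1.1 * p.1.2 + (splitForm K k p.2.1 + g p.2.2) = 0} := by
      refine (Nat.card_congr (Equiv.subtypeEquiv ((Equiv.prodAssoc _ _ _).symm.trans
        (Equiv.prodCongr (Fin.consEquiv fun _ => K × K) (Equiv.refl A))) fun p => ?_)).symm
      simp [splitForm, QuadraticMap.pi_apply, Fin.sum_univ_succ, Fin.consEquiv, add_assoc]
    have h2 := VirtualQuadraticSpace.card_mul_add_eq_zero
      (fun p : (Fin k → K × K) × A => splitForm K k p.1 + g p.2)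
    have h3 : (Nat.card ((Fin k → K × K) × A) : ℤ) = (Nat.card K : ℤ) ^ (2 * k) * Nat.card A := by
      rw [Nat.card_prod, Nat.card_fun, Nat.card_prod, Nat.card_fin, ← pow_two, ← pow_mul]
      push_cast
      rfl
    rw [h3] at h2
    rw [h1, h2]
    linear_combination (Nat.card K : ℤ) * ih

lemma binaryForm_apply (a b c : K) (p : K × K) :
    binaryForm a b c p = a * p.1 ^ 2 + b * p.1 * p.2 + c * p.2 ^ 2 := by
  simp [binaryForm]
  ring

lemma binaryForm_eq_zero_iff {b e : K} (h : ∀ t : K, t ^ 2 + b * t + e ≠ 0) (p : K × K) :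
    binaryForm 1 b e p = 0 ↔ p = 0 := by
  refine ⟨fun hp => ?_, fun hp => by simp [hp]⟩
  obtain ⟨x, y⟩ := p
  rw [binaryForm_apply] at hp
  dsimp only at hp
  by_cases hy : y = 0
  · subst hy
    simpa using hp
  · refine absurd ?_ (h (x / y))
    field_simp
    linear_combination hp

end QuadraticForm

namespace VirtualQuadraticSpace

open QuadraticMap Module

variable {K V : Type*} [Field K] [AddCommGroup V] [Module K V] {S : VirtualQuadraticSpace K V}

lemma numZeros_eq_of_equivalent {M : Type*} [AddCommGroup M] [Module K M]
    {Q : QuadraticForm K M} (h : QuadraticMap.Equivalent S.subform Q) :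
    S.numZeros = Nat.card {x : M // Q x = 0} ∧ finrank K S.subspace = finrank K M := by
  obtain ⟨φ⟩ := h
  refine ⟨Nat.card_congr (Equiv.subtypeEquiv φ.toEquiv fun x => ?_), φ.toLinearEquiv.finrank_eq⟩
  have : Q (φ x) = S.form x := φ.map_app x
  rw [← this]
  rfl

lemma numZeros_eq_of_equivalent_prod [Finite K] {k : ℕ} {b e : K}
    (h : ∀ t : K, t ^ 2 + b * t + e ≠ 0)
    (hS : QuadraticMap.Equivalent S.subform
      ((QuadraticForm.splitForm K k).prod (QuadraticForm.binaryForm 1 b e))) :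
    (Nat.card K : ℤ) * S.numZeros = (Nat.card K : ℤ) ^ (k + 1) +
      (Nat.card K : ℤ) ^ k * ((Nat.card K : ℤ) ^ k - 1) * (Nat.card K : ℤ) ^ 2 ∧
    finrank K S.subspace = 2 * (k + 1) := by
  obtain ⟨h1, h2⟩ := numZeros_eq_of_equivalent hS
  have h3 := QuadraticForm.card_splitForm_add_eq_zero (QuadraticForm.binaryForm 1 b e) k
  have h4 : Nat.card {p : K × K // QuadraticForm.binaryForm 1 b e p = 0} = 1 := by
    simp only [QuadraticForm.binaryForm_eq_zero_iff h]
    exact Nat.card_unique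
  rw [h4, Nat.card_prod] at h3
  refine ⟨?_, ?_⟩
  · rw [h1]
    simp only [QuadraticMap.prod_apply]
    rw [h3]
    push_cast
    ring
  · rw [h2, finrank_prod, finrank_pi_fintype]
    simp
    ring

lemma numZeros_of_isOfType [Finite K] {k : ℕ} (h : finrank K S.subspace = 2 * (k + 1)) {ε : ℤ}
    (hε : QuadraticForm.IsOfType S.subform ε) :
    (S.numZeros : ℤ) = (Nat.card K : ℤ) ^ (2 * k + 1) +
      ε * ((Nat.card K : ℤ) ^ (k + 1) - (Nat.card K : ℤ) ^ k) := by
  have hq : (Nat.card K : ℤ) ≠ 0 := by exact_mod_cast Nat.card_pos.ne'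
  refine mul_left_cancel₀ hq ?_
  rcases hε with ⟨rfl, m, hm⟩ | ⟨rfl, m, e, ⟨-, he, hm⟩ | ⟨-, he, hm⟩⟩
  · obtain ⟨h1, h2⟩ := numZeros_eq_of_equivalent hm
    have h3 := QuadraticForm.card_splitForm_add_eq_zero (fun _ : Unit => (0 : K)) m
    have h4 : Nat.card {p : (Fin m → K × K) × Unit // QuadraticForm.splitForm K m p.1 + 0 = 0} =
        S.numZeros := by
      rw [h1]
      exact Nat.card_congr (Equiv.subtypeEquiv (Equiv.prodPUnit _) fun p => by simp)
    rw [h4] at h3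
    have h5 : Nat.card {_a : Unit // (0 : K) = 0} = 1 := by simp
    rw [h5] at h3
    obtain rfl : m = k + 1 := by
      rw [finrank_pi_fintype] at h2
      simp at h2
      omega
    rw [h3]
    simp
    ring
  · obtain ⟨h1, h2⟩ := numZeros_eq_of_equivalent_prod
      (fun t ht => he ⟨t, by linear_combination -ht⟩) hm
    obtain rfl : m = k := by omega
    rw [h1]
    ring
  · obtain ⟨h1, h2⟩ := numZeros_eq_of_equivalent_prod
      (fun t ht => he t (by linear_combination ht)) hm
    obtain rfl : m = k := by omega
    rw [h1]
    ring

/-- The form of a non-degenerate space of odd dimension has as many zeros as a non-zero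
linear form. -/
lemma IsNondegenerate.numZeros_of_odd [Finite K] (hS : S.IsNondegenerate) {k : ℕ}
    (h : finrank K S.subspace = 2 * k + 1) : S.numZeros = Nat.card K ^ (2 * k) := by
  induction k generalizing S with
  | zero =>
    have : FiniteDimensional K S.subspace := FiniteDimensional.of_finrank_pos (by omega)
    have : Finite S.subspace := Module.finite_of_finite K
    have hpos : 0 < S.numZeros := by
      have : Nonempty {x : S.subspace // S.form x = 0} := ⟨⟨0, by simp⟩⟩
      exact Nat.card_pos
    by_contra hne
    obtain ⟨e, he, he0, hQ⟩ := exists_singular_iff.2 (by simp at hne; omega : 1 < S.numZeros)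
    obtain ⟨f, hf⟩ := hS.exists_isHyperbolicPair he he0 hQ
    have := hf.finrank_eq
    omega
  | succ k ih =>
    have : FiniteDimensional K S.subspace := FiniteDimensional.of_finrank_pos (by omega)
    obtain ⟨e, he, he0, hQ⟩ := exists_singular_of_three_le_finrank (S := S) (by omega)
    obtain ⟨f, hf⟩ := hS.exists_isHyperbolicPair he he0 hQ
    have hT : finrank K ((S.cut e).cut f).subspace = 2 * k + 1 := by
      have := hf.finrank_eq
      omega
    have h1 := hf.numZeros_eq
    rw [ih (hf.isNondegenerate_cut_cut hS) hT, hT] at h1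
    zify
    rw [h1]
    push_cast
    ring

/-! ### The orders of the groups -/

lemma IsNondegenerate.card_isometryGroup_of_odd [Finite K] (hS : S.IsNondegenerate) {k : ℕ}
    (h : finrank K S.subspace = 2 * k + 1) :
    (Nat.card S.isometryGroup : ℤ) =
      2 * (Nat.card K : ℤ) ^ (k ^ 2) *
        ∏ i ∈ Finset.Icc 1 k, ((Nat.card K : ℤ) ^ (2 * i) - 1) := by
  induction k generalizing S with
  | zero =>
    have : FiniteDimensional K S.subspace := FiniteDimensional.of_finrank_pos (by omega)
    obtain ⟨w, hw, hw0⟩ := exists_mem_ne_zero_of_finrank_pos (S := S) (by omega)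
    rw [card_isometryGroup_of_finrank_eq_one h hw fun hQ => ?_]
    · simp
    · obtain ⟨f, hf⟩ := hS.exists_isHyperbolicPair hw hw0 hQ
      have := hf.finrank_eq
      omega
  | succ k ih =>
    have : FiniteDimensional K S.subspace := FiniteDimensional.of_finrank_pos (by omega)
    obtain ⟨e, he, he0, hQ⟩ := exists_singular_of_three_le_finrank (S := S) (by omega)
    obtain ⟨f, hf⟩ := hS.exists_isHyperbolicPair he he0 hQ
    have hT : finrank K ((S.cut e).cut f).subspace = 2 * k + 1 := by
      have := hf.finrank_eq
      omega
    rw [hf.card_isometryGroup hS, ih (hf.isNondegenerate_cut_cut hS) hT, hT,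
      hS.numZeros_of_odd h, Finset.prod_Icc_succ_top (by omega)]
    push_cast
    ring

/-- The order in even dimension, the type of the form being expressed by its number of zeros. -/
lemma IsNondegenerate.card_isometryGroup_of_even [Finite K] (hS : S.IsNondegenerate) {k : ℕ}
    (h : finrank K S.subspace = 2 * (k + 1)) {ε : ℤ} (hε : ε = 1 ∨ ε = -1)
    (hN : (S.numZeros : ℤ) = (Nat.card K : ℤ) ^ (2 * k + 1) +
      ε * ((Nat.card K : ℤ) ^ (k + 1) - (Nat.card K : ℤ) ^ k)) :
    (Nat.card S.isometryGroup : ℤ) =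
      2 * (Nat.card K : ℤ) ^ (k ^ 2 + k) * ((Nat.card K : ℤ) ^ (k + 1) - ε) *
        ∏ i ∈ Finset.Icc 1 k, ((Nat.card K : ℤ) ^ (2 * i) - 1) := by
  have hfd : FiniteDimensional K S.subspace := FiniteDimensional.of_finrank_pos (by omega)
  have hfin : Finite S.subspace := Module.finite_of_finite K
  have hq : (1 : ℤ) < Nat.card K := by exact_mod_cast (Finite.one_lt_card : 1 < Nat.card K)
  have hε2 : ε ^ 2 = 1 := by rcases hε with rfl | rfl <;> norm_num
  induction k generalizing S with
  | zero =>
    rcases hε with rfl | rfl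
    · obtain ⟨e, he, he0, hQ⟩ := exists_singular_iff.2 (by zify; rw [hN]; simp; omega)
      obtain ⟨f, hf⟩ := hS.exists_isHyperbolicPair he he0 hQ
      have hT : finrank K ((S.cut e).cut f).subspace = 0 := by
        have := hf.finrank_eq
        omega
      rw [hf.card_isometryGroup hS, hT, card_isometryGroup_of_finrank_eq_zero hT, hN]
      simp
      ring
    · rw [card_isometryGroup_of_anisotropic_plane h fun e he hQ => ?_]
      · simp
      · by_contra he0
        have := exists_singular_iff.1 ⟨e, he, he0, hQ⟩
        zify at this
        rw [hN] at this
        simp at this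
  | succ k ih =>
    obtain ⟨e, he, he0, hQ⟩ := exists_singular_of_three_le_finrank (S := S) (by omega)
    obtain ⟨f, hf⟩ := hS.exists_isHyperbolicPair he he0 hQ
    have hT : finrank K ((S.cut e).cut f).subspace = 2 * (k + 1) := by
      have := hf.finrank_eq
      omega
    have hNT : (((S.cut e).cut f).numZeros : ℤ) = (Nat.card K : ℤ) ^ (2 * k + 1) +
        ε * ((Nat.card K : ℤ) ^ (k + 1) - (Nat.card K : ℤ) ^ k) := by
      have h1 := hf.numZeros_eq
      rw [hN, hT] at h1
      refine mul_left_cancel₀ (by omega : (Nat.card K : ℤ) ≠ 0) ?_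
      linear_combination -h1
    rw [hf.card_isometryGroup hS, ih (hf.isNondegenerate_cut_cut hS) hT hNT inferInstance
      (Module.finite_of_finite K), hT, hN, Finset.prod_Icc_succ_top (by omega)]
    -- Because `ε ^ 2 = 1`, there are `(q ^ (k + 2) - ε) * (q ^ (k + 1) + ε)` non-zero singular
    -- vectors, and the second factor completes `q ^ (k + 1) - ε` to `q ^ (2 * (k + 1)) - 1`.
    linear_combination (2 * (Nat.card K : ℤ) ^ (2 * k + 2 + (k ^ 2 + k)) *
      (∏ i ∈ Finset.Icc 1 k, ((Nat.card K : ℤ) ^ (2 * i) - 1)) *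
      ((Nat.card K : ℤ) ^ (k + 1) - (Nat.card K : ℤ) ^ (k + 2))) * hε2

end VirtualQuadraticSpace

theorem mainTheorem4 {K V : Type*} [Field K] [Finite K] [AddCommGroup V] [Module K V]
    (q : ℕ) (hq : Nat.card K = q)
    (S : VirtualQuadraticSpace K V) [FiniteDimensional K S.subspace]
    (hS : S.IsNondegenerate) (k : ℕ) :
    (∀ ε : ℤ, 1 ≤ k → Module.finrank K S.subspace = 2 * k →
      QuadraticForm.IsOfType S.subform ε →
      (Nat.card S.isometryGroup : ℤ) =
        2 * (q : ℤ) ^ (k ^ 2 - k) * ((q : ℤ) ^ k - ε) *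
          ∏ i ∈ Finset.Icc 1 (k - 1), ((q : ℤ) ^ (2 * i) - 1)) ∧
    (Module.finrank K S.subspace = 2 * k + 1 →
      (Nat.card S.isometryGroup : ℤ) =
        2 * (q : ℤ) ^ (k ^ 2) * ∏ i ∈ Finset.Icc 1 k, ((q : ℤ) ^ (2 * i) - 1)) := by
  subst hq
  refine ⟨fun ε hk h hε => ?_, fun h => hS.card_isometryGroup_of_odd h⟩
  obtain ⟨m, rfl⟩ := Nat.exists_eq_add_of_le' hk
  have hε1 : ε = 1 ∨ ε = -1 := hε.imp And.left And.left
  have hexp : (m + 1) ^ 2 - (m + 1) = m ^ 2 + m := by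
    rw [Nat.sub_eq_iff_eq_add (by nlinarith)]
    ring
  rw [hexp, Nat.add_sub_cancel]
  exact hS.card_isometryGroup_of_even h hε1 (VirtualQuadraticSpace.numZeros_of_isOfType h hε)
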